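/- A continuous propositional logic is a non-empty set $\mathcal S$ (of "formulas") equipped with two unary operations $\neg,\frac12$ and a binary operation $\mathbin{\dot-}$, not required to satisfy any law; in particular $\mathcal S$ need not be freely generated. A truth assignment is a map $v\colon\mathcal S\to[0,1]$ with $v(\neg\varphi)=1-v(\varphi)$, $v(\frac12\varphi)=\frac12 v(\varphi)$ and $v(\varphi\mathbin{\dot-}\psi)=\max(v(\varphi)-v(\psi),0)$ for all $\varphi,\psi\in\mathcal S$. It is a model of $\Sigma\subseteq\mathcal S$ if $v(\varphi)=0$ for all $\varphi\in\Sigma$ (the value $0$ means "true"). $\Sigma$ is satisfiable if it has a model, and $\Sigma\models\varphi$ means that $v(\varphi)=0$ for every model $v$ of $\Sigma$. Write $\varphi\wedge\psi$ for $\varphi\mathbin{\dot-}(\varphi\mathbin{\dot-}\psi)$. The logical axioms are all formulas of the following forms, for $\varphi,\psi,\rho\in\mathcal S$: (A1) $(\varphi\mathbin{\dot-}\psi)\mathbin{\dot-}\varphi$; (A2) $((\rho\mathbin{\dot-}\varphi)\mathbin{\dot-}(\rho\mathbin{\dot-}\psi))\mathbin{\dot-}(\psi\mathbin{\dot-}\varphi)$;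 (A3) $(\varphi\wedge\psi)\mathbin{\dot-}(\psi\wedge\varphi)$; (A4) $(\varphi\mathbin{\dot-}\psi)\mathbin{\dot-}(\neg\psi\mathbin{\dot-}\neg\varphi)$; (A5) $\frac12\varphi\mathbin{\dot-}(\varphi\mathbin{\dot-}\frac12\varphi)$; (A6) $(\varphi\mathbin{\dot-}\frac12\varphi)\mathbin{\dot-}\frac12\varphi$. $\Sigma\vdash\varphi$ means that $\varphi$ can be deduced in finitely many steps from members of $\Sigma$ and logical axioms by Modus Ponens (from $\varphi$ and $\psi\mathbin{\dot-}\varphi$ infer $\psi$). $\Sigma$ is contradictory if $\Sigma\vdash\varphi$ for every $\varphi\in\mathcal S$, and consistent otherwise. For a formula $\varphi_0$ let $1=\neg(\varphi_0\mathbin{\dot-}\varphi_0)$ and let $2^{-n}=\frac12\cdots\frac12 1$ ($n$ times). Theorem. Let $\mathcal S$ be a continuous propositional logic and $\Sigma\subseteq\mathcal S$. Then $\Sigma$ is consistent if and only if it is satisfiable. Moreover, for every $\varphi\in\mathcal S$, and for every choice of the formula $\varphi_0\in\mathcal S$ used to define $1$, one has $\Sigma\models\varphi$ if and only if $\Sigma\vdash\varphi\mathbin{\dot-}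 2^{-n}$ for all $n\in\mathbb N$. -/

import Mathlib

/-- A continuous propositional logic: a non-empty set with two unary operations and one binary
operation.  No law is imposed; in particular the logic need not be freely generated. -/
class ContPropLogic (S : Type*) where
  nonempty : Nonempty S
  neg : S → S
  half : S → S
  dotminus : S → S → S

namespace ContPropLogic

infixl:65 " ∸ " => ContPropLogic.dotminus

variable {S : Type*} [ContPropLogic S]

/-- Truth assignments: maps to `[0,1]` respecting the connectives, where `x ∸ y = max (x - y) 0`
in `[0,1]`. -/
structure IsTruthAssignment (v : S → Set.Icc (0 : ℝ) 1) : Prop where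
  map_neg : ∀ φ : S, (v (neg φ) : ℝ) = 1 - (v φ : ℝ)
  map_half : ∀ φ : S, (v (half φ) : ℝ) = (v φ : ℝ) / 2
  map_dotminus : ∀ φ ψ : S, (v (φ ∸ ψ) : ℝ) = max ((v φ : ℝ) - (v ψ : ℝ)) 0

/-- A model of `Γ` is a truth assignment giving every member of `Γ` the value `0` (truth). -/
def IsModel (v : S → Set.Icc (0 : ℝ) 1) (Γ : Set S) : Prop :=
  IsTruthAssignment v ∧ ∀ φ ∈ Γ, (v φ : ℝ) = 0

def Satisfiable (Γ : Set S) : Prop :=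
  ∃ v : S → Set.Icc (0 : ℝ) 1, IsModel v Γ

/-- Semantic entailment: every model of `Γ` is a model of `φ`. -/
def Entails (Γ : Set S) (φ : S) : Prop :=
  ∀ v : S → Set.Icc (0 : ℝ) 1, IsModel v Γ → IsModel v {φ}

/-- The abbreviation `φ ∧ ψ`. -/
def meet (φ ψ : S) : S := φ ∸ (φ ∸ ψ)

/-- The logical axiom schemes. -/
inductive IsAxiom : S → Prop
  | a1 (φ ψ : S) : IsAxiom ((φ ∸ ψ) ∸ φ)
  | a2 (φ ψ ρ : S) : IsAxiom (((ρ ∸ φ) ∸ (ρ ∸ ψ)) ∸ (ψ ∸ φ))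
  | a3 (φ ψ : S) : IsAxiom (meet φ ψ ∸ meet ψ φ)
  | a4 (φ ψ : S) : IsAxiom ((φ ∸ ψ) ∸ (neg ψ ∸ neg φ))
  | a5 (φ : S) : IsAxiom (half φ ∸ (φ ∸ half φ))
  | a6 (φ : S) : IsAxiom ((φ ∸ half φ) ∸ half φ)

/-- `Deducible Γ φ`: there is a formal deduction of `φ` from the premises `Γ`, using the axiom
schemes and modus ponens (`ψ ∸ φ` plays the role of the implication from `φ` to `ψ`). -/
inductive Deducible (Γ : Set S) : S → Prop
  | premise {φ : S} : φ ∈ Γ → Deducible Γ φ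
  | logical {φ : S} : IsAxiom φ → Deducible Γ φ
  | mp {φ ψ : S} : Deducible Γ φ → Deducible Γ (ψ ∸ φ) → Deducible Γ ψ

def Contradictory (Γ : Set S) : Prop := ∀ φ : S, Deducible Γ φ

def Consistent (Γ : Set S) : Prop := ¬ Contradictory Γ

/-- The abbreviation `1`, which depends on the choice of a formula `φ₀`. -/
def one (φ₀ : S) : S := neg (φ₀ ∸ φ₀)

/-- The abbreviation `2^{-n}`: the connective `half` applied `n` times to `1`. -/
def dyadic (φ₀ : S) (n : ℕ) : S := half^[n] (one φ₀)

end ContPropLogic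

/-! Soundness is a direct check. For the converse, Zorn's lemma enlarges a consistent set to a
maximal consistent Δ, and [0,1]-values are read off from its Lindenbaum algebra, where A1–A4 give
the Łukasiewicz laws.

The deduction theorem holds only up to repetition: φ follows from Γ and ψ only if φ minus finitely
many copies of ψ is zero. Prelinearity (`sub_sub_sub_comm_self`) makes this enough: y - x is
unchanged by subtracting x - y any number of times. So if adding ψ ∸ φ to Γ is contradictory, then Γ
proves φ ∸ ψ (`deducible_sub_of_contradictory_insert`), and the algebra of Δ is totally ordered.

By A5 and A6 the formulas 2^{-n} are iterated halves of the top element, and their multiples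
calculate like dyadic rationals. Totality squeezes every element between consecutive multiples, and
the resulting cut is a real number respecting subtraction (`value_sub`). Infinitesimals may survive
in the algebra and are sent to 0.

If φ is entailed by Γ, then Γ with 2^{-n} ∸ φ added has no model, so it is contradictory, and the
same lemma yields φ ∸ 2^{-n}. -/

/-- Łukasiewicz algebras (equivalently, Wajsberg or MV-algebras) presented by truncated subtraction
and complement, where `0` is the designated value and `x - y = 0` defines the order. -/
class LukasiewiczAlgebra (A : Type*) extends Zero A, Sub A, Compl A where
  eq_of_sub_eq_zero (x y : A) : x - y = 0 → y - x = 0 → x = y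
  eq_zero_of_sub_zero (x : A) : x - 0 = 0 → x = 0
  sub_sub_self_left (x y : A) : x - y - x = 0
  sub_sub_sub_sub (x y z : A) : z - x - (z - y) - (y - x) = 0
  meet_sub_meet (x y : A) : x - (x - y) - (y - (y - x)) = 0
  sub_sub_compl_sub_compl (x y : A) : x - y - (yᶜ - xᶜ) = 0
  compl_compl (x : A) : xᶜᶜ = x

/-! ### Order and subtraction in Łukasiewicz algebras -/

namespace LukasiewiczAlgebra

variable {A : Type*} [LukasiewiczAlgebra A]

theorem meet_comm (x y : A) : x - (x - y) = y - (y - x) :=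
  eq_of_sub_eq_zero _ _ (meet_sub_meet x y) (meet_sub_meet y x)

theorem zero_sub (x : A) : 0 - x = 0 :=
  eq_zero_of_sub_zero _ (sub_sub_self_left 0 x)

theorem sub_zero (x : A) : x - 0 = x :=
  eq_of_sub_eq_zero _ _ (sub_sub_self_left x 0) (by rw [meet_comm, zero_sub])

theorem sub_self (x : A) : x - x = 0 := by
  have h := sub_sub_sub_sub (0 : A) 0 x
  rwa [zero_sub, sub_zero, sub_zero] at h

instance : PartialOrder A where
  le x y := x - y = 0
  le_refl := sub_self
  le_trans x y z hxy hyz := by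
    have h := sub_sub_sub_sub z y x
    rwa [hxy, hyz, sub_zero, sub_zero] at h
  le_antisymm := eq_of_sub_eq_zero

theorem le_iff {x y : A} : x ≤ y ↔ x - y = 0 := Iff.rfl

theorem zero_le (x : A) : 0 ≤ x := zero_sub x

theorem le_zero_iff {x : A} : x ≤ 0 ↔ x = 0 := by rw [le_iff, sub_zero]

theorem sub_le (x y : A) : x - y ≤ x := sub_sub_self_left x y

theorem sub_sub_sub_le (x y z : A) : z - x - (z - y) ≤ y - x := sub_sub_sub_sub x y z

theorem meet_le_right (x y : A) : x - (x - y) ≤ y := by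
  rw [meet_comm]; exact sub_le _ _

theorem sub_le_sub_left {x y : A} (h : x ≤ y) (z : A) : z - y ≤ z - x := by
  have h' := sub_sub_sub_sub y x z
  rwa [le_iff.1 h, sub_zero] at h'

theorem sub_le_sub_right {x y : A} (h : x ≤ y) (z : A) : x - z ≤ y - z := by
  have h' := sub_sub_sub_sub z y x
  rwa [le_iff.1 h, sub_zero] at h'

theorem sub_le_sub {a b c d : A} (h : a ≤ b) (h' : c ≤ d) : a - d ≤ b - c :=
  (sub_le_sub_right h d).trans (sub_le_sub_left h' b)

/-- Replacing z by the smaller x - (x - z) turns the left side into an instance of A2. -/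
theorem sub_right_comm_le (x y z : A) : x - y - z ≤ x - z - y :=
  (sub_le_sub_left (meet_le_right x z) _).trans (sub_sub_sub_le _ _ _)

theorem sub_right_comm (x y z : A) : x - y - z = x - z - y :=
  le_antisymm (sub_right_comm_le x y z) (sub_right_comm_le x z y)

theorem meet_eq_right {x y : A} (h : y ≤ x) : x - (x - y) = y := by
  rw [meet_comm, le_iff.1 h, sub_zero]

theorem le_meet {w x y : A} (hx : w ≤ x) (hy : w ≤ y) : w ≤ x - (x - y) := by
  rw [← meet_eq_right hx]
  exact sub_le_sub_left (sub_le_sub_left hy x) x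

theorem compl_sub_compl (x y : A) : yᶜ - xᶜ = x - y := by
  refine le_antisymm ?_ (sub_sub_compl_sub_compl x y)
  have h : yᶜ - xᶜ ≤ xᶜᶜ - yᶜᶜ := sub_sub_compl_sub_compl _ _
  rwa [compl_compl, compl_compl] at h

theorem compl_sub_comm (x y : A) : xᶜ - y = yᶜ - x := by
  rw [← compl_sub_compl xᶜ y, compl_compl]

theorem sub_compl_comm (x y : A) : x - yᶜ = y - xᶜ := by
  rw [← compl_sub_compl x yᶜ, compl_compl]

theorem compl_le_compl {x y : A} (h : x ≤ y) : yᶜ ≤ xᶜ := by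
  rw [le_iff, compl_sub_compl]; exact h

theorem compl_zero_sub (x : A) : (0 : A)ᶜ - x = xᶜ := by
  rw [compl_sub_comm, sub_zero]

theorem le_compl_zero (x : A) : x ≤ (0 : A)ᶜ := by
  rw [le_iff, sub_compl_comm, zero_sub]

/-- Prelinearity: `x - y` and `y - x` are disjoint. -/
theorem sub_sub_sub_comm_self (x y : A) : y - x - (x - y) = y - x := by
  refine le_antisymm (sub_le _ _) ?_
  set e := (y - x) - (y - x - (x - y)) with he
  set m := x - (x - y) with hm
  have hex : e ≤ x - m := by
    have h1 : e ≤ x - y := meet_le_right _ _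
    exact h1.trans (sub_le_sub_left (meet_le_right x y) x)
  have hey : e ≤ y - m := (sub_le _ _).trans (sub_le_sub_left (sub_le _ _) y)
  -- Here (mᶜ - e)ᶜ is the truncated sum m + e. It lies below both x and y, hence below their meet
  -- m; since e ≤ mᶜ the sum is not truncated, so e = 0.
  have aux : ∀ {z : A}, m ≤ z → e ≤ z - m → (mᶜ - e)ᶜ ≤ z := by
    intro z hmz hez
    have h1 : mᶜ - (mᶜ - zᶜ) ≤ mᶜ - e := sub_le_sub_left (by rwa [compl_sub_compl]) _
    rw [meet_eq_right (compl_le_compl hmz)] at h1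
    have h2 := compl_le_compl h1
    rwa [compl_compl] at h2
  have hx := aux (sub_le _ _) hex
  have hy := aux (meet_le_right _ _) hey
  have hmm : (mᶜ - e)ᶜ ≤ m := le_meet hx hy
  have hc : mᶜ ≤ mᶜ - e := by
    have := compl_le_compl hmm
    rwa [compl_compl] at this
  have hem : e ≤ mᶜ := by
    have := hex.trans (sub_le_sub_right (le_compl_zero x) m)
    rwa [compl_zero_sub] at this
  have h0 : e = 0 := by
    rw [← meet_eq_right hem]
    exact hc
  exact h0

theorem iterate_sub_of_sub_eq {c d : A} (h : d - c = d) (m : ℕ) : (· - c)^[m] d = d :=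
  Function.iterate_fixed h m

theorem iterate_sub_mono (c : A) (m : ℕ) : Monotone ((· - c)^[m]) :=
  Monotone.iterate (fun _ _ h => sub_le_sub_right h c) m

theorem iterate_sub_sub (c x y : A) (m : ℕ) :
    (· - c)^[m] (x - y) = (· - c)^[m] x - y := by
  induction m with
  | zero => rfl
  | succ m ih => rw [Function.iterate_succ_apply', ih, Function.iterate_succ_apply',
      sub_right_comm]

/-! ### Truncated addition and multiples -/

instance : Add A where
  add x y := (xᶜ - y)ᶜ

theorem add_def (x y : A) : x + y = (xᶜ - y)ᶜ := rfl

theorem add_comm (x y : A) : x + y = y + x := by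
  rw [add_def, add_def, compl_sub_comm]

theorem sub_add (x y z : A) : x - (y + z) = x - y - z := by
  rw [add_def, sub_compl_comm, sub_right_comm, compl_sub_compl]

theorem add_zero (x : A) : x + 0 = x := by
  rw [add_def, sub_zero, compl_compl]

theorem zero_add (x : A) : 0 + x = x := by rw [add_comm, add_zero]

theorem add_assoc (x y z : A) : x + y + z = x + (y + z) := by
  rw [add_def (x + y), add_def x (y + z), sub_add, add_def x y, compl_compl]

theorem le_add_right (x y : A) : x ≤ x + y := by
  rw [le_iff, sub_add, sub_self, zero_sub]

theorem add_le_add_right {x y : A} (h : x ≤ y) (z : A) : x + z ≤ y + z :=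
  compl_le_compl (sub_le_sub_right (compl_le_compl h) z)

theorem sub_add_cancel {x y : A} (h : y ≤ x) : x - y + y = x := by
  rw [add_comm, add_def, ← compl_sub_compl x y, meet_eq_right (compl_le_compl h), compl_compl]

theorem add_sub_cancel_right {x y : A} (h : x ≤ yᶜ) : x + y - y = x := by
  rw [add_def, compl_sub_comm (xᶜ - y) y, compl_sub_comm x y, meet_eq_right h]

/-- Truncated natural multiples. -/
def multiple : ℕ → A → A
  | 0, _ => 0
  | k + 1, x => multiple k x + x

theorem multiple_mono (x : A) : Monotone fun k => multiple k x :=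
  monotone_nat_of_le_succ fun _ => le_add_right _ _

theorem multiple_two_mul (k : ℕ) (x : A) : multiple (2 * k) x = multiple k (x + x) := by
  induction k with
  | zero => rfl
  | succ k ih =>
    change multiple (2 * k) x + x + x = multiple k (x + x) + (x + x)
    rw [ih, add_assoc]

/-! ### Dyadic arithmetic along a halving sequence -/

/-- A sequence starting at the top element, each term being half of the preceding one. -/
structure IsHalvingSeq (u : ℕ → A) : Prop where
  zero : u 0 = (0 : A)ᶜ
  succ : ∀ n, u n - u (n + 1) = u (n + 1)

namespace IsHalvingSeq

variable {u : ℕ → A}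

theorem succ_le (hu : IsHalvingSeq u) (n : ℕ) : u (n + 1) ≤ u n := by
  rw [← hu.succ n]; exact sub_le _ _

theorem add_self (hu : IsHalvingSeq u) (n : ℕ) : u (n + 1) + u (n + 1) = u n := by
  have h := sub_add_cancel (hu.succ_le n)
  rwa [hu.succ] at h

theorem ne_zero (hu : IsHalvingSeq u) (h1 : (0 : A)ᶜ ≠ 0) (n : ℕ) : u n ≠ 0 := by
  induction n with
  | zero => rwa [hu.zero]
  | succ n ih =>
    intro h
    apply ih
    rw [← hu.add_self, h, add_zero]

/-- Below 2 ^ n copies of `u n` nothing is truncated: one more copy still fits. In the inductive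
step 2j + 1 copies of `u (n + 1)` are j copies of `u n` plus one `u (n + 1)`. -/
theorem multiple_le_compl_aux (hu : IsHalvingSeq u) (n : ℕ) :
    ∀ k, k + 1 = 2 ^ n → multiple k (u n) ≤ (u n)ᶜ := by
  induction n with
  | zero =>
    intro k hk
    obtain rfl : k = 0 := by simpa using hk
    exact zero_le _
  | succ n ih =>
    intro k hk
    have hpos : 0 < 2 ^ n := by positivity
    obtain ⟨j, hj⟩ : ∃ j, j + 1 = 2 ^ n := ⟨2 ^ n - 1, by omega⟩
    obtain rfl : k = 2 * j + 1 := by rw [pow_succ] at hk; omega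
    change multiple (2 * j) (u (n + 1)) + u (n + 1) ≤ _
    rw [multiple_two_mul, hu.add_self]
    refine (add_le_add_right (ih j hj) _).trans (le_of_eq ?_)
    have hc : (u n)ᶜ = (u (n + 1))ᶜ - u (n + 1) := by
      rw [← hu.add_self n, add_def, compl_compl]
    rw [hc, sub_add_cancel]
    -- Half of an element lies below its own complement, so the cancellation is exact.
    have h := sub_le_sub_right (le_compl_zero (u n)) (u (n + 1))
    rwa [hu.succ, compl_zero_sub] at h

theorem multiple_le_compl (hu : IsHalvingSeq u) {n k : ℕ} (hk : k < 2 ^ n) :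
    multiple k (u n) ≤ (u n)ᶜ :=
  (multiple_mono (u n) (show k ≤ 2 ^ n - 1 by omega)).trans
    (hu.multiple_le_compl_aux n _ (by omega))

theorem multiple_two_pow_mul (hu : IsHalvingSeq u) (n m k : ℕ) :
    multiple (2 ^ m * k) (u (n + m)) = multiple k (u n) := by
  induction m with
  | zero => simp
  | succ m ih => rw [pow_succ', mul_assoc, multiple_two_mul, ← Nat.add_assoc, hu.add_self, ih]

theorem multiple_two_pow (hu : IsHalvingSeq u) (n : ℕ) :
    multiple (2 ^ n) (u n) = (0 : A)ᶜ := by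
  have h := hu.multiple_two_pow_mul 0 n 1
  rw [mul_one, Nat.zero_add, hu.zero] at h
  rw [h]
  exact zero_add _

/-- The bound on a rules out saturation at the top; b is free, since both subtractions truncate at
zero. -/
theorem multiple_sub (hu : IsHalvingSeq u) {n a : ℕ} (ha : a ≤ 2 ^ n) (b : ℕ) :
    multiple a (u n) - multiple b (u n) = multiple (a - b) (u n) := by
  induction b with
  | zero => exact sub_zero _
  | succ b ih =>
    change _ - (multiple b (u n) + u n) = _
    rw [sub_add, ih, ← Nat.sub_sub]
    rcases hc : a - b with _ | c
    · exact zero_sub _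
    · exact add_sub_cancel_right (hu.multiple_le_compl (by omega))

theorem le_of_multiple_le (hu : IsHalvingSeq u) (h1 : (0 : A)ᶜ ≠ 0) {n a b : ℕ} (ha : a ≤ 2 ^ n)
    (h : multiple a (u n) ≤ multiple b (u n)) : a ≤ b := by
  by_contra! hab
  rw [le_iff, hu.multiple_sub ha] at h
  apply hu.ne_zero h1 n
  rw [← le_zero_iff, ← h]
  have h' := multiple_mono (u n) (show 1 ≤ a - b by omega)
  exact (zero_add (u n)).symm.le.trans h'

/-- Compare over the common denominator 2 ^ (m + n). -/
theorem mul_le_mul_of_multiple_le (hu : IsHalvingSeq u) (h1 : (0 : A)ᶜ ≠ 0) {m n a b : ℕ}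
    (ha : a ≤ 2 ^ m) (h : multiple a (u m) ≤ multiple b (u n)) : 2 ^ n * a ≤ 2 ^ m * b := by
  rw [← hu.multiple_two_pow_mul m n a, ← hu.multiple_two_pow_mul n m b, Nat.add_comm n m] at h
  refine hu.le_of_multiple_le h1 ?_ h
  rw [Nat.add_comm m n, pow_add]
  exact Nat.mul_le_mul_left _ ha

theorem exists_multiple_le_le (hu : IsHalvingSeq u) (total : ∀ x y : A, x ≤ y ∨ y ≤ x)
    (x : A) (n : ℕ) :
    ∃ k < 2 ^ n, multiple k (u n) ≤ x ∧ x ≤ multiple (k + 1) (u n) := by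
  -- Descend from the top element, which is 2 ^ n copies of `u n`, until totality puts x above a
  -- multiple.
  have aux : ∀ K, x ≤ multiple (K + 1) (u n) →
      ∃ k ≤ K, multiple k (u n) ≤ x ∧ x ≤ multiple (k + 1) (u n) := by
    intro K
    induction K with
    | zero => exact fun h => ⟨0, le_rfl, zero_le x, h⟩
    | succ K ih =>
      intro h
      rcases total x (multiple (K + 1) (u n)) with h' | h'
      · obtain ⟨k, hk, hkx⟩ := ih h'
        exact ⟨k, hk.trans (Nat.le_succ K), hkx⟩
      · exact ⟨K + 1, le_rfl, h', h⟩
  have hpos : 0 < 2 ^ n := by positivity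
  obtain ⟨k, hk, hkx⟩ := aux (2 ^ n - 1) (by
    rw [Nat.sub_add_cancel hpos, hu.multiple_two_pow]; exact le_compl_zero x)
  exact ⟨k, by omega, hkx⟩

end IsHalvingSeq

/-! ### The real value of an element -/

/-- The value in `[0,1]` of an element, measured along a halving sequence. -/
noncomputable def value (u : ℕ → A) (x : A) : ℝ :=
  sSup {r : ℝ | ∃ n k : ℕ, k ≤ 2 ^ n ∧ multiple k (u n) ≤ x ∧ r = (k : ℝ) / 2 ^ n}

namespace IsHalvingSeq

variable {u : ℕ → A}

theorem le_value {n k : ℕ} {x : A} (hk : k ≤ 2 ^ n) (h : multiple k (u n) ≤ x) :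
    (k : ℝ) / 2 ^ n ≤ value u x := by
  refine le_csSup ⟨1, ?_⟩ ⟨n, k, hk, h, rfl⟩
  rintro _ ⟨m, j, hj, -, rfl⟩
  rw [div_le_one (by positivity)]
  exact_mod_cast hj

theorem value_nonneg (x : A) : 0 ≤ value u x := by
  simpa using le_value (u := u) (n := 0) (k := 0) (Nat.zero_le _) (zero_le x)

theorem value_le (hu : IsHalvingSeq u) (h1 : (0 : A)ᶜ ≠ 0) {n k : ℕ} {x : A}
    (h : x ≤ multiple k (u n)) : value u x ≤ (k : ℝ) / 2 ^ n := by
  refine csSup_le ⟨_, 0, 0, Nat.zero_le _, zero_le x, rfl⟩ ?_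
  rintro _ ⟨m, j, hj, hjx, rfl⟩
  rw [div_le_div_iff₀ (by positivity) (by positivity)]
  have := hu.mul_le_mul_of_multiple_le h1 hj (hjx.trans h)
  have : (2 : ℝ) ^ n * j ≤ 2 ^ m * k := by exact_mod_cast this
  linarith

theorem value_le_one (hu : IsHalvingSeq u) (h1 : (0 : A)ᶜ ≠ 0) (x : A) : value u x ≤ 1 := by
  have h : x ≤ multiple (2 ^ 0) (u 0) := by rw [hu.multiple_two_pow]; exact le_compl_zero x
  simpa using hu.value_le h1 h

theorem value_zero (hu : IsHalvingSeq u) (h1 : (0 : A)ᶜ ≠ 0) : value u (0 : A) = 0 :=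
  le_antisymm (by simpa using hu.value_le h1 (n := 0) (k := 0) (zero_le _)) (value_nonneg _)

theorem value_compl_zero (hu : IsHalvingSeq u) (h1 : (0 : A)ᶜ ≠ 0) :
    value u (0 : A)ᶜ = 1 := by
  refine le_antisymm (hu.value_le_one h1 _) ?_
  simpa using le_value (u := u) (n := 0) (k := 2 ^ 0) le_rfl (hu.multiple_two_pow 0).le

theorem value_sub (hu : IsHalvingSeq u) (h1 : (0 : A)ᶜ ≠ 0) (total : ∀ x y : A, x ≤ y ∨ y ≤ x)
    (x y : A) : value u (x - y) = max (value u x - value u y) 0 := by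
  -- With x in [i, i+1] and y in [j, j+1] in units of 2^{-n}, both quantities lie between the
  -- truncations of i - j - 1 and i - j + 1, hence the factor 2.
  have key : ∀ n : ℕ, |value u (x - y) - max (value u x - value u y) 0| ≤ 2 * (1 / 2 : ℝ) ^ n := by
    intro n
    obtain ⟨i, hi, hix, hxi⟩ := hu.exists_multiple_le_le total x n
    obtain ⟨j, hj, hjy, hyj⟩ := hu.exists_multiple_le_le total y n
    have lower : ((i - (j + 1) : ℕ) : ℝ) / 2 ^ n ≤ value u (x - y) :=
      le_value (by omega) (by rw [← hu.multiple_sub hi.le]; exact sub_le_sub hix hyj)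
    have upper : value u (x - y) ≤ ((i + 1 - j : ℕ) : ℝ) / 2 ^ n :=
      hu.value_le h1 (by rw [← hu.multiple_sub hi]; exact sub_le_sub hxi hjy)
    have hx := le_value hi.le hix
    have hx' := hu.value_le h1 hxi
    have hy := le_value hj.le hjy
    have hy' := hu.value_le h1 hyj
    have hnonneg := value_nonneg (u := u) (x - y)
    rw [one_div, inv_pow]
    simp only [div_eq_mul_inv] at *
    set ε : ℝ := (2 ^ n)⁻¹
    have hε : 0 < ε := by positivity
    push_cast at hx' hy'
    rw [add_mul, one_mul] at hx' hy'
    have hl : ((i : ℝ) - (j + 1)) * ε ≤ value u (x - y) := by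
      refine le_trans (mul_le_mul_of_nonneg_right ?_ hε.le) lower
      have : (i : ℝ) ≤ ((i - (j + 1) : ℕ) : ℝ) + (j + 1) := by
        exact_mod_cast (by omega : i ≤ i - (j + 1) + (j + 1))
      linarith
    have hup : value u (x - y) ≤ max ((i + 1 - j : ℝ) * ε) 0 := by
      rcases le_total j (i + 1) with hij | hij
      · rw [Nat.cast_sub hij] at upper
        push_cast at upper
        exact le_max_of_le_left upper
      · rw [Nat.sub_eq_zero_of_le hij] at upper
        exact le_max_of_le_right (by simpa using upper)
    rw [abs_le]
    constructor
    · have : max (value u x - value u y) 0 ≤ value u (x - y) + 2 * ε :=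
        max_le (by linarith) (by linarith)
      linarith
    · have : max ((i + 1 - j : ℝ) * ε) 0 ≤ max (value u x - value u y) 0 + 2 * ε := by
        refine max_le ?_ ?_
        · linarith [le_max_left (value u x - value u y) 0]
        · linarith [le_max_right (value u x - value u y) 0]
      linarith
  have lim : Filter.Tendsto (fun n : ℕ => 2 * (1 / 2 : ℝ) ^ n) Filter.atTop (nhds 0) := by
    simpa using (tendsto_pow_atTop_nhds_zero_of_lt_one (r := (1 / 2 : ℝ))
      (by norm_num) (by norm_num)).const_mul 2
  have h0 := ge_of_tendsto' lim key
  exact sub_eq_zero.1 (abs_nonpos_iff.1 h0)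

end IsHalvingSeq

end LukasiewiczAlgebra

/-! ### Formal deductions and the Lindenbaum algebra -/

namespace ContPropLogic

variable {S : Type*} [ContPropLogic S] {Γ : Set S}

namespace Deducible

theorem mono {Δ : Set S} (h : Γ ⊆ Δ) {φ : S} (hφ : Deducible Γ φ) : Deducible Δ φ := by
  induction hφ with
  | premise hφ => exact premise (h hφ)
  | logical hφ => exact logical hφ
  | mp _ _ ih ih' => exact mp ih ih'

theorem weaken {φ : S} (h : Deducible Γ φ) (ψ : S) : Deducible Γ (φ ∸ ψ) :=
  mp h (logical (.a1 φ ψ))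

theorem trans {φ ψ ρ : S} (h : Deducible Γ (φ ∸ ψ)) (h' : Deducible Γ (ψ ∸ ρ)) :
    Deducible Γ (φ ∸ ρ) :=
  mp h (mp h' (logical (.a2 ρ ψ φ)))

theorem sub_sub_of_deducible {τ : S} (h : Deducible Γ τ) (φ : S) :
    Deducible Γ (φ ∸ (φ ∸ τ)) :=
  mp (h.weaken _) (logical (.a3 φ τ))

theorem sub_self (φ : S) : Deducible Γ (φ ∸ φ) :=
  trans (sub_sub_of_deducible (logical (.a1 φ φ)) φ) (logical (.a1 _ _))

theorem sub_congr_left {φ ψ : S} (h : Deducible Γ (φ ∸ ψ)) (ρ : S) :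
    Deducible Γ ((φ ∸ ρ) ∸ (ψ ∸ ρ)) :=
  trans (sub_sub_of_deducible h _) (logical (.a2 ρ ψ φ))

theorem sub_congr_right {φ ψ : S} (h : Deducible Γ (φ ∸ ψ)) (ρ : S) :
    Deducible Γ ((ρ ∸ ψ) ∸ (ρ ∸ φ)) :=
  mp h (logical (.a2 ψ φ ρ))

/-- With φ ∸ φ in the role of 0, apply A4 twice to φ ∸ 0 and drop the last subtrahend by A1. -/
theorem sub_neg_neg (φ : S) : Deducible Γ (φ ∸ neg (neg φ)) :=
  trans (sub_sub_of_deducible (sub_self φ) φ)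
    (trans (logical (.a4 φ (φ ∸ φ))) (trans (logical (.a4 _ _)) (logical (.a1 _ _))))

theorem neg_neg_sub (φ : S) : Deducible Γ (neg (neg φ) ∸ φ) :=
  mp (sub_neg_neg (neg φ)) (logical (.a4 _ _))

theorem neg_sub_neg {φ ψ : S} (h : Deducible Γ (φ ∸ ψ)) : Deducible Γ (neg ψ ∸ neg φ) :=
  mp (trans (neg_neg_sub φ) (trans h (sub_neg_neg ψ))) (logical (.a4 _ _))

end Deducible

/-- Provable equivalence over `Γ`. -/
def provableSetoid (Γ : Set S) : Setoid S where
  r φ ψ := Deducible Γ (φ ∸ ψ) ∧ Deducible Γ (ψ ∸ φ)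
  iseqv :=
    { refl := fun φ => ⟨.sub_self φ, .sub_self φ⟩
      symm := fun h => ⟨h.2, h.1⟩
      trans := fun h h' => ⟨h.1.trans h'.1, h'.2.trans h.2⟩ }

/-- The Lindenbaum algebra of `Γ`. -/
def Lindenbaum (Γ : Set S) : Type _ := Quotient (provableSetoid Γ)

namespace Lindenbaum

/-- The class of a formula. -/
def of (Γ : Set S) (φ : S) : Lindenbaum Γ := Quotient.mk (provableSetoid Γ) φ

instance : Sub (Lindenbaum Γ) where
  sub := Quotient.map₂ (· ∸ ·) fun _ _ h _ _ h' =>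
    ⟨(h.1.sub_congr_left _).trans (h'.2.sub_congr_right _),
      (h.2.sub_congr_left _).trans (h'.1.sub_congr_right _)⟩

instance : Compl (Lindenbaum Γ) where
  compl := Quotient.map neg fun _ _ h => ⟨h.2.neg_sub_neg, h.1.neg_sub_neg⟩

noncomputable instance : Zero (Lindenbaum Γ) where
  zero :=
    let φ := Classical.choice (ContPropLogic.nonempty (S := S))
    of Γ (φ ∸ φ)

theorem of_sub (φ ψ : S) : of Γ (φ ∸ ψ) = of Γ φ - of Γ ψ := rfl

theorem of_neg (φ : S) : of Γ (neg φ) = (of Γ φ)ᶜ := rfl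

theorem of_eq_of {φ ψ : S} :
    of Γ φ = of Γ ψ ↔ Deducible Γ (φ ∸ ψ) ∧ Deducible Γ (ψ ∸ φ) :=
  Quotient.eq (r := provableSetoid Γ)

/-- All deducible formulas are equivalent by A1, so zero does not depend on the formula chosen to
define it. -/
theorem of_eq_zero {φ : S} : of Γ φ = 0 ↔ Deducible Γ φ :=
  of_eq_of.trans ⟨fun h => .mp (.sub_self _) h.1, fun h => ⟨h.weaken _, .weaken (.sub_self _) _⟩⟩

theorem of_surjective (x : Lindenbaum Γ) : ∃ φ, of Γ φ = x := Quotient.exists_rep x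

noncomputable instance : LukasiewiczAlgebra (Lindenbaum Γ) where
  eq_of_sub_eq_zero x y h h' := by
    obtain ⟨φ, rfl⟩ := of_surjective x
    obtain ⟨ψ, rfl⟩ := of_surjective y
    exact of_eq_of.2 ⟨of_eq_zero.1 h, of_eq_zero.1 h'⟩
  eq_zero_of_sub_zero x h := by
    obtain ⟨φ, rfl⟩ := of_surjective x
    exact of_eq_zero.2 (.mp (.sub_self _) (of_eq_zero.1 h))
  sub_sub_self_left x y := by
    obtain ⟨φ, rfl⟩ := of_surjective x
    obtain ⟨ψ, rfl⟩ := of_surjective y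
    exact of_eq_zero.2 (.logical (.a1 φ ψ))
  sub_sub_sub_sub x y z := by
    obtain ⟨φ, rfl⟩ := of_surjective x
    obtain ⟨ψ, rfl⟩ := of_surjective y
    obtain ⟨ρ, rfl⟩ := of_surjective z
    exact of_eq_zero.2 (.logical (.a2 φ ψ ρ))
  meet_sub_meet x y := by
    obtain ⟨φ, rfl⟩ := of_surjective x
    obtain ⟨ψ, rfl⟩ := of_surjective y
    exact of_eq_zero.2 (.logical (.a3 φ ψ))
  sub_sub_compl_sub_compl x y := by
    obtain ⟨φ, rfl⟩ := of_surjective x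
    obtain ⟨ψ, rfl⟩ := of_surjective y
    exact of_eq_zero.2 (.logical (.a4 φ ψ))
  compl_compl x := by
    obtain ⟨φ, rfl⟩ := of_surjective x
    exact of_eq_of.2 ⟨.neg_neg_sub φ, .sub_neg_neg φ⟩

theorem of_le_of {φ ψ : S} : of Γ φ ≤ of Γ ψ ↔ Deducible Γ (φ ∸ ψ) :=
  of_eq_zero (φ := φ ∸ ψ)

theorem of_one (φ₀ : S) : of Γ (one φ₀) = 0ᶜ := by
  rw [one, of_neg, of_eq_zero.2 (.sub_self φ₀)]

theorem of_sub_half (φ : S) : of Γ φ - of Γ (half φ) = of Γ (half φ) :=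
  of_eq_of.2 ⟨.logical (.a6 φ), .logical (.a5 φ)⟩

theorem isHalvingSeq_of_dyadic (φ₀ : S) :
    LukasiewiczAlgebra.IsHalvingSeq fun n => of Γ (dyadic φ₀ n) where
  zero := of_one φ₀
  succ n := by
    simp only [dyadic, Function.iterate_succ_apply']
    exact of_sub_half _

end Lindenbaum

/-! ### Deduction theorem, maximal consistent sets and models -/

open LukasiewiczAlgebra Lindenbaum

/-- Contradiction is witnessed by one formula, so it passes from the union of a chain to a member.
-/
theorem contradictory_iff_deducible_one (φ₀ : S) :
    Contradictory Γ ↔ Deducible Γ (one φ₀) := by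
  refine ⟨fun h => h _, fun h φ => ?_⟩
  rw [← of_eq_zero, ← LukasiewiczAlgebra.le_zero_iff, ← of_eq_zero.2 h, of_one]
  exact le_compl_zero _

/-- A form of the deduction theorem. -/
theorem Deducible.exists_iterate_sub {φ ψ : S} (h : Deducible (insert ψ Γ) φ) :
    ∃ m : ℕ, (· - of Γ ψ)^[m] (of Γ φ) = 0 := by
  induction h with
  | premise hφ =>
    rcases hφ with rfl | hφ
    · exact ⟨1, LukasiewiczAlgebra.sub_self _⟩
    · exact ⟨0, of_eq_zero.2 (.premise hφ)⟩
  | logical hφ => exact ⟨0, of_eq_zero.2 (.logical hφ)⟩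
  | @mp φ χ _ _ ih ih' =>
    obtain ⟨m, hm⟩ := ih
    obtain ⟨n, hn⟩ := ih'
    -- After n subtractions χ is below φ, and m more bring φ to zero.
    refine ⟨m + n, ?_⟩
    rw [of_sub, iterate_sub_sub] at hn
    rw [Function.iterate_add_apply, ← LukasiewiczAlgebra.le_zero_iff, ← hm]
    exact iterate_sub_mono _ m hn

/-- Some number of subtractions of ψ ∸ φ annihilates 1, hence also the smaller φ ∸ ψ, which
prelinearity says they leave fixed. -/
theorem deducible_sub_of_contradictory_insert {φ ψ : S}
    (h : Contradictory (insert (ψ ∸ φ) Γ)) : Deducible Γ (φ ∸ ψ) := by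
  obtain ⟨m, hm⟩ := (h (one φ)).exists_iterate_sub
  rw [← of_eq_zero, ← LukasiewiczAlgebra.le_zero_iff, ← hm, of_one, of_sub, of_sub,
    ← iterate_sub_of_sub_eq (sub_sub_sub_comm_self (of Γ ψ) (of Γ φ)) m]
  exact iterate_sub_mono _ m (le_compl_zero _)

theorem Deducible.exists_mem_of_sUnion {c : Set (Set S)} (hc : IsChain (· ⊆ ·) c)
    (hne : c.Nonempty) {φ : S} (h : Deducible (⋃₀ c) φ) : ∃ Δ ∈ c, Deducible Δ φ := by
  induction h with
  | premise hφ =>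
    obtain ⟨Δ, hΔ, hφ⟩ := hφ
    exact ⟨Δ, hΔ, .premise hφ⟩
  | logical hφ => exact hne.imp fun Δ hΔ => ⟨hΔ, .logical hφ⟩
  | mp _ _ ih ih' =>
    obtain ⟨Δ, hΔ, h⟩ := ih
    obtain ⟨Δ', hΔ', h'⟩ := ih'
    rcases hc.total hΔ hΔ' with hs | hs
    · exact ⟨Δ', hΔ', .mp (h.mono hs) h'⟩
    · exact ⟨Δ, hΔ, .mp h (h'.mono hs)⟩

theorem Consistent.exists_maximal (h : Consistent Γ) : ∃ Δ, Γ ⊆ Δ ∧ Maximal Consistent Δ := by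
  obtain ⟨φ₀⟩ := ContPropLogic.nonempty (S := S)
  refine zorn_subset_nonempty {Δ : Set S | Consistent Δ} ?_ Γ h
  intro c hcs hc hne
  refine ⟨⋃₀ c, fun hcon => ?_, fun Δ hΔ => Set.subset_sUnion_of_mem hΔ⟩
  obtain ⟨Δ, hΔ, hd⟩ := (hcon (one φ₀)).exists_mem_of_sUnion hc hne
  exact hcs hΔ ((contradictory_iff_deducible_one φ₀).2 hd)

theorem total_of_maximal (h : Maximal Consistent Γ) (x y : Lindenbaum Γ) : x ≤ y ∨ y ≤ x := by
  obtain ⟨φ, rfl⟩ := of_surjective x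
  obtain ⟨ψ, rfl⟩ := of_surjective y
  rw [of_le_of, of_le_of]
  by_cases hc : Contradictory (insert (ψ ∸ φ) Γ)
  · exact .inl (deducible_sub_of_contradictory_insert hc)
  · exact .inr (.premise (h.2 hc (Set.subset_insert _ _) (Set.mem_insert _ _)))

theorem Consistent.satisfiable (h : Consistent Γ) : Satisfiable Γ := by
  obtain ⟨φ₀⟩ := ContPropLogic.nonempty (S := S)
  obtain ⟨Δ, hΓ, hΔ⟩ := h.exists_maximal
  have hu := isHalvingSeq_of_dyadic (Γ := Δ) φ₀
  have total := total_of_maximal hΔ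
  have h1 : (0 : Lindenbaum Δ)ᶜ ≠ 0 := by
    rw [← of_one φ₀, Ne, of_eq_zero, ← contradictory_iff_deducible_one]
    exact hΔ.1
  set u : ℕ → Lindenbaum Δ := fun n => of Δ (dyadic φ₀ n)
  refine ⟨fun φ => ⟨value u (of Δ φ), IsHalvingSeq.value_nonneg _, hu.value_le_one h1 _⟩,
    ⟨fun φ => ?_, fun φ => ?_, fun φ ψ => hu.value_sub h1 total (of Δ φ) (of Δ ψ)⟩, fun φ hφ => ?_⟩
  · change value u (of Δ φ)ᶜ = 1 - value u (of Δ φ)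
    rw [← compl_zero_sub, hu.value_sub h1 total, hu.value_compl_zero h1,
      max_eq_left (sub_nonneg.2 (hu.value_le_one h1 _))]
  · change value u (of Δ (half φ)) = value u (of Δ φ) / 2
    have hs := hu.value_sub h1 total (of Δ φ) (of Δ (half φ))
    rw [of_sub_half] at hs
    have hφ := IsHalvingSeq.value_nonneg (u := u) (of Δ φ)
    -- The half has value h = max (a - h) 0, where a is the value of φ; if the maximum is 0, then a
    -- ≤ h = 0.
    rcases max_choice (value u (of Δ φ) - value u (of Δ (half φ))) 0 with hm | hm
    · linarith
    · have := le_max_left (value u (of Δ φ) - value u (of Δ (half φ))) 0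
      linarith
  · change value u (of Δ φ) = 0
    rw [of_eq_zero.2 (.premise (hΓ hφ)), hu.value_zero h1]

/-! ### Soundness -/

section Soundness

variable {v : S → Set.Icc (0 : ℝ) 1}

theorem IsTruthAssignment.map_isAxiom (hv : IsTruthAssignment v) {φ : S} (h : IsAxiom φ) :
    (v φ : ℝ) = 0 := by
  cases h <;> simp only [meet, hv.map_neg, hv.map_half, hv.map_dotminus] <;> grind

theorem IsModel.map_deducible (hv : IsModel v Γ) {φ : S} (h : Deducible Γ φ) :
    (v φ : ℝ) = 0 := by
  induction h with
  | premise hφ => exact hv.2 _ hφ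
  | logical hφ => exact hv.1.map_isAxiom hφ
  | @mp φ ψ _ _ ih ih' =>
    rw [hv.1.map_dotminus, ih, _root_.sub_zero] at ih'
    exact le_antisymm ((le_max_left _ _).trans_eq ih') (v ψ).2.1

theorem IsTruthAssignment.map_one (hv : IsTruthAssignment v) (φ₀ : S) : (v (one φ₀) : ℝ) = 1 := by
  simp [one, hv.map_neg, hv.map_dotminus]

theorem IsTruthAssignment.map_dyadic (hv : IsTruthAssignment v) (φ₀ : S) (n : ℕ) :
    (v (dyadic φ₀ n) : ℝ) = (1 / 2) ^ n := by
  induction n with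
  | zero => simpa [dyadic] using hv.map_one φ₀
  | succ n ih =>
    rw [dyadic] at ih
    rw [dyadic, Function.iterate_succ_apply', hv.map_half, ih, pow_succ]
    ring

end Soundness

/-! ### Consistency of satisfiable sets and approximated completeness -/

theorem Satisfiable.consistent (h : Satisfiable Γ) : Consistent Γ := by
  obtain ⟨φ₀⟩ := ContPropLogic.nonempty (S := S)
  obtain ⟨v, hv⟩ := h
  intro hc
  have := hv.map_deducible (hc (one φ₀))
  rw [hv.1.map_one] at this
  exact one_ne_zero this

theorem Entails.deducible_sub_dyadic {φ : S} (h : Entails Γ φ) (φ₀ : S) (n : ℕ) :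
    Deducible Γ (φ ∸ dyadic φ₀ n) := by
  apply deducible_sub_of_contradictory_insert
  by_contra hc
  -- Such a model gives φ a value of at least 2^{-n}, although entailment forces 0.
  obtain ⟨v, hv⟩ := Consistent.satisfiable hc
  have hφ := (h v ⟨hv.1, fun ψ hψ => hv.2 ψ (Set.mem_insert_of_mem _ hψ)⟩).2 φ rfl
  have hd := hv.2 _ (Set.mem_insert _ _)
  rw [hv.1.map_dotminus, hv.1.map_dyadic, hφ, _root_.sub_zero,
    max_eq_left (by positivity)] at hd
  have : (0 : ℝ) < (1 / 2) ^ n := by positivity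
  exact this.ne' hd

theorem entails_of_forall_deducible_sub_dyadic {φ φ₀ : S}
    (h : ∀ n, Deducible Γ (φ ∸ dyadic φ₀ n)) : Entails Γ φ := by
  rintro v hv
  refine ⟨hv.1, ?_⟩
  rintro _ rfl
  refine le_antisymm (ge_of_tendsto' (tendsto_pow_atTop_nhds_zero_of_lt_one (r := (1 / 2 : ℝ))
    (by norm_num) (by norm_num)) fun n => ?_) (v _).2.1
  have hn := hv.map_deducible (h n)
  rw [hv.1.map_dotminus, hv.1.map_dyadic] at hn
  exact sub_nonpos.1 ((le_max_left _ _).trans_eq hn)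

end ContPropLogic

theorem mainTheorem8 {S : Type*} [ContPropLogic S] (Γ : Set S) :
    (ContPropLogic.Consistent Γ ↔ ContPropLogic.Satisfiable Γ) ∧
      ∀ φ φ₀ : S, ContPropLogic.Entails Γ φ ↔
        ∀ n : ℕ, ContPropLogic.Deducible Γ
          (φ ∸ ContPropLogic.dyadic φ₀ n) :=
  ⟨⟨ContPropLogic.Consistent.satisfiable, ContPropLogic.Satisfiable.consistent⟩,
    fun _ φ₀ => ⟨fun h n => h.deducible_sub_dyadic φ₀ n,
      ContPropLogic.entails_of_forall_deducible_sub_dyadic⟩⟩
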